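/- Let $f:\mathbb R^n\to\mathbb R$ be continuously differentiable with gradient $f_\theta$, and let $\theta^l,\theta^u$ be vectors of bounds, where $(\theta^l)_i=-\infty$ and $(\theta^u)_i=+\infty$ are allowed. Consider the problem of minimizing $f$ over the box $\mathbb D_f=\{\theta\in\mathbb R^n:\theta^l\le\theta\le\theta^u\}$, written as $g(\theta)\le 0$ with $g(\theta)=(\theta-\theta^u,\,-\theta+\theta^l)$ and Jacobi matrix $g_\theta=\begin{bmatrix}I\\-I\end{bmatrix}$. A point $\theta\in\mathbb D_f$ is a KKT point if there is $\pi\in\mathbb R^{2n}$ with $f_\theta+g_\theta^T\pi=0$, $\pi_k\ge 0$ whenever $g_k(\theta)=0$, and $\pi_k=0$ whenever $g_k(\theta)\ne 0$. Let $K_\theta$ be a diagonal positive-definite $n\times n$ gain matrix, constant or depending continuously on $\theta$, and let $\theta_0\in\mathbb D_f$ be arbitrary. *Limited integrator.* Integrate $-K_\theta f_\theta$ from $\theta_0$ at time $\tau_0$ with an anti-windup limited integrator with limits $\theta^l,\theta^u$. That is, consider trajectories $\theta:[\tau_0,\infty)\to\mathbb D_f$ that are absolutely continuous on bounded intervals,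 with $\theta(\tau_0)=\theta_0$ and, with $x=-K_\theta f_\theta$, for almost every $\tau$ and all $i$, $$\frac{d\theta_i}{d\tau}=\begin{cases}0&\text{if }\theta_i=(\theta^u)_i,\ x_i\ge0,\\0&\text{if }\theta_i=(\theta^l)_i,\ x_i\le0,\\x_i&\text{otherwise.}\end{cases}\tag{A}$$ *General QP-based dynamic method.* At $\theta\in\mathbb D_f$ let $u$ minimize $\tfrac12 f_\theta^Tu+\tfrac14u^TK_\theta^{-1}u$ subject to $(g_k)_\theta^Tu\le0$ for all $k$ with $g_k(\theta)=0$; let $\mathbb I_p$ be the set of those $k$ with $g_k(\theta)=0$ and $(g_k)_\theta^Tu=0$, and $h$ the matrix of the rows $k\in\mathbb I_p$ of $g_\theta$. Let $\pi_I\in\mathbb R^{2n}$ be $0$ off $\mathbb I_p$ and equal to $-(hK_\theta h^T)^{-1}hK_\theta f_\theta$ on $\mathbb I_p$, where the inverse is required to exist and $\pi_I\ge 0$ is required. The method follows $$\frac{d\theta}{d\tau}=-K_\theta\,(f_\theta+g_\theta^T\pi_I),\qquad \theta(\tau)\in\mathbb D_f,\quad \theta(\tau_0)=\theta_0.\tag{B}$$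 1. Suppose $(\theta^l)_i<(\theta^u)_i$ for all $i$. Then at every $\theta\in\mathbb D_f$ the right-hand side of (B) is well defined and equals the right-hand side of (A), and the trajectories of (A) on $[\tau_0,\infty)$ starting at $\theta_0$ are exactly those of (B). 2. Let $\theta$ be any trajectory of (A) on $[\tau_0,\infty)$ starting at $\theta_0$. As $\tau\to+\infty$ it satisfies the KKT conditions, without any strict complementarity assumption, in the following sense. Every cluster point of $\theta(\tau)$ as $\tau\to+\infty$ (in particular its limit, if it converges) is a KKT point. If the trajectory is bounded, which is the case whenever $\{p\in\mathbb D_f:f(p)\le f(\theta_0)\}$ is bounded, then KKT points exist and the distance from $\theta(\tau)$ to the set of KKT points tends to $0$ as $\tau\to+\infty$. -/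

import Mathlib

open Set Filter Topology MeasureTheory
open scoped Matrix

namespace BoxDynamics

noncomputable section

/-- The vector `f_θ` of first-order partial derivatives of `f` at `θ`. -/
def grad {n : ℕ} (f : (Fin n → ℝ) → ℝ) (θ : Fin n → ℝ) : Fin n → ℝ :=
  fun i => fderiv ℝ f θ (Pi.single i 1)

/-- The `2n` inequality constraints `g(θ) = (θ - θᵘ, -θ + θˡ)` of the box. The bounds are extended
reals, so that `-∞` and `+∞` stand for missing bounds. -/
def constr {n : ℕ} (θl θu : Fin n → EReal) (θ : Fin n → ℝ) : Fin n ⊕ Fin n → EReal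
  | Sum.inl i => (θ i : EReal) - θu i
  | Sum.inr i => θl i - (θ i : EReal)

/-- The feasible region `{θ | g(θ) ≤ 0}`. -/
def feasible {n : ℕ} (θl θu : Fin n → EReal) : Set (Fin n → ℝ) :=
  {θ | ∀ k, constr θl θu θ k ≤ 0}

/-- The indices of the active constraints at `θ`. -/
def active {n : ℕ} (θl θu : Fin n → EReal) (θ : Fin n → ℝ) : Set (Fin n ⊕ Fin n) :=
  {k | constr θl θu θ k = 0}

/-- The Jacobi matrix of `g`: the identity on top of minus the identity. -/
def constrJac (n : ℕ) : Matrix (Fin n ⊕ Fin n) (Fin n) ℝ :=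
  Matrix.fromRows 1 (-1)

/-- `θ` is feasible and satisfies the Karush-Kuhn-Tucker conditions of the box-constrained problem:
`f_θ + g_θᵀ π = 0` with `π_k ≥ 0` for the active constraints and `π_k = 0` for the others. -/
def IsKKT {n : ℕ} (f : (Fin n → ℝ) → ℝ) (θl θu : Fin n → EReal) (θ : Fin n → ℝ) : Prop :=
  θ ∈ feasible θl θu ∧ ∃ π : Fin n ⊕ Fin n → ℝ,
    grad f θ + (constrJac n)ᵀ *ᵥ π = 0 ∧
    (∀ k ∈ active θl θu θ, 0 ≤ π k) ∧
    (∀ k ∉ active θl θu θ, π k = 0)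

/-! ### The limited integrator -/

open Classical in
/-- The rate of the anti-windup limited integrator with lower limit `b` and upper limit `a`, at
output `y` and input `x`. -/
def limitedRate (b a : EReal) (y x : ℝ) : ℝ :=
  if (y : EReal) = a ∧ 0 ≤ x then 0
  else if (y : EReal) = b ∧ x ≤ 0 then 0
  else x

/-- `y` is on `[t₀, ∞)` the output of the limited integrator with limits `b ≤ a`, initial value
`y₀` and input `x`: it stays within the limits, and it is the integral of its limited rate
(that is, `y` is absolutely continuous and `dy/dt` is the limited rate almost everywhere). -/
def IsLimitedIntegral (b a : EReal) (t₀ y₀ : ℝ) (x y : ℝ → ℝ) : Prop :=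
  ∀ t, t₀ ≤ t → b ≤ (y t : EReal) ∧ (y t : EReal) ≤ a ∧
    IntervalIntegrable (fun s => limitedRate b a (y s) (x s)) volume t₀ t ∧
    y t = y₀ + ∫ s in t₀..t, limitedRate b a (y s) (x s)

/-- `θ` solves on `[τ₀, ∞)` the limited integral equation obtained by integrating `-K_θ f_θ`
from `θ₀` with limits `θˡ` and `θᵘ` in every component. -/
def IsLimitedSolution {n : ℕ} (f : (Fin n → ℝ) → ℝ) (K : (Fin n → ℝ) → Matrix (Fin n) (Fin n) ℝ)
    (θl θu : Fin n → EReal) (τ₀ : ℝ) (θ₀ : Fin n → ℝ) (θ : ℝ → Fin n → ℝ) : Prop :=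
  ∀ i, IsLimitedIntegral (θl i) (θu i) τ₀ (θ₀ i)
    (fun s => (-(K (θ s) *ᵥ grad f (θ s))) i) (fun s => θ s i)

/-! ### The general dynamic method based on a quadratic program -/

/-- The objective `½ f_θᵀ u + ½ (½ uᵀ K_θ⁻¹ u)` of the quadratic program at `θ`. -/
def qpObjective {n : ℕ} (f : (Fin n → ℝ) → ℝ) (K : (Fin n → ℝ) → Matrix (Fin n) (Fin n) ℝ)
    (θ u : Fin n → ℝ) : ℝ :=
  1 / 2 * (grad f θ ⬝ᵥ u) + 1 / 2 * (1 / 2 * (u ⬝ᵥ ((K θ)⁻¹ *ᵥ u)))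

/-- The feasible controls `u` of the quadratic program at `θ`: `(g_k)_θᵀ u ≤ 0` for every
constraint `k` that is active at `θ`. -/
def qpFeasible {n : ℕ} (θl θu : Fin n → EReal) (θ : Fin n → ℝ) : Set (Fin n → ℝ) :=
  {u | ∀ k ∈ active θl θu θ, constrJac n k ⬝ᵥ u ≤ 0}

/-- `u` solves the quadratic program at `θ`. -/
def IsQPSolution {n : ℕ} (f : (Fin n → ℝ) → ℝ) (K : (Fin n → ℝ) → Matrix (Fin n) (Fin n) ℝ)
    (θl θu : Fin n → EReal) (θ u : Fin n → ℝ) : Prop :=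
  u ∈ qpFeasible θl θu θ ∧ ∀ w ∈ qpFeasible θl θu θ, qpObjective f K θ u ≤ qpObjective f K θ w

/-- The constraints of the quadratic program at `θ` that are active at the control `u`. -/
def qpActive {n : ℕ} (θl θu : Fin n → EReal) (θ u : Fin n → ℝ) : Set (Fin n ⊕ Fin n) :=
  {k | k ∈ active θl θu θ ∧ constrJac n k ⬝ᵥ u = 0}

/-- The Jacobi matrix of the constraints with index in `I`: the rows `k ∈ I` of `g_θ`. -/
def subJac {n : ℕ} (I : Set (Fin n ⊕ Fin n)) : Matrix I (Fin n) ℝ :=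
  (constrJac n).submatrix Subtype.val id

open Classical in
/-- `v` is the velocity that the general dynamic method prescribes at `θ`: solve the quadratic
program, let `I` be the set of its constraints that are active at the solution `u` and `h` their
Jacobi matrix, put `π = -(h K_θ hᵀ)⁻¹ h K_θ f_θ` on `I` (the inverse has to exist and `π` has to
be nonnegative) and `π = 0` off `I`; then `v = -K_θ (f_θ + g_θᵀ π)`. -/
def IsGeneralVelocity {n : ℕ} (f : (Fin n → ℝ) → ℝ)
    (K : (Fin n → ℝ) → Matrix (Fin n) (Fin n) ℝ)
    (θl θu : Fin n → EReal) (θ v : Fin n → ℝ) : Prop :=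
  ∃ u, IsQPSolution f K θl θu θ u ∧
    ∃ π : Fin n ⊕ Fin n → ℝ,
      (∀ k ∉ qpActive θl θu θ u, π k = 0) ∧
      (∀ k ∈ qpActive θl θu θ u, 0 ≤ π k) ∧
      IsUnit (subJac (qpActive θl θu θ u) * K θ * (subJac (qpActive θl θu θ u))ᵀ).det ∧
      (fun k : qpActive θl θu θ u => π k) =
        -((subJac (qpActive θl θu θ u) * K θ * (subJac (qpActive θl θu θ u))ᵀ)⁻¹ *ᵥ
          (subJac (qpActive θl θu θ u) *ᵥ (K θ *ᵥ grad f θ))) ∧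
      v = -(K θ *ᵥ (grad f θ + (constrJac n)ᵀ *ᵥ π))

/-- `θ` solves on `[τ₀, ∞)` the differential equation of the general dynamic method, which operates
in the feasible region, with initial value `θ₀`. As the right-hand side is discontinuous, solutions
are absolutely continuous functions. -/
def IsGeneralSolution {n : ℕ} (f : (Fin n → ℝ) → ℝ)
    (K : (Fin n → ℝ) → Matrix (Fin n) (Fin n) ℝ)
    (θl θu : Fin n → EReal) (τ₀ : ℝ) (θ₀ : Fin n → ℝ) (θ : ℝ → Fin n → ℝ) : Prop :=
  ∃ v : ℝ → Fin n → ℝ, ∀ t, τ₀ ≤ t → θ t ∈ feasible θl θu ∧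
    IsGeneralVelocity f K θl θu (θ t) (v t) ∧
    IntervalIntegrable v volume τ₀ t ∧
    θ t = θ₀ + ∫ s in τ₀..t, v s

end

end BoxDynamics

namespace BoxDynamics

section

variable {n : ℕ} {f : (Fin n → ℝ) → ℝ} {K : (Fin n → ℝ) → Matrix (Fin n) (Fin n) ℝ}
  {θl θu : Fin n → EReal}

/-! Since `K` is diagonal, everything splits into coordinates.

Equivalence of the methods: the quadratic program becomes one-dimensional strictly convex problems
whose unique minimizer is the limited rate (`isQPSolution_iff`). If the bounds of each coordinate
differ, at most one constraint per coordinate is active, so `h K hᵀ` is an invertible diagonal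
matrix and the multipliers cancel the gradient exactly in the blocked coordinates
(`isGeneralVelocity_iff`).

Convergence: `f` is a Lyapunov function with derivative `-∑ rateᵢ² / Kᵢᵢ` almost everywhere. The
field is discontinuous, so continuity of the flow cannot be invoked. Instead, near a point `p` of
nonzero rate the dissipation is at least some `c > 0` (`exists_eventually_le_dissipation`), and the
bounded speed makes each visit close to `p` last at least a fixed time `Δ` (`mem_ball`). If `p` were
a cluster point, a visit with `f` below `f p + c * Δ` would push `f` below `f p`, which bounds `f`
from below along the trajectory. So cluster points have zero rate, and those are KKT points;
compactness gives the rest. -/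

lemma coe_sub_le_zero (y : ℝ) (a : EReal) : (y : EReal) - a ≤ 0 ↔ (y : EReal) ≤ a := by
  induction a with
  | bot => simp
  | top => simp
  | coe a => norm_cast; exact sub_nonpos

lemma coe_sub_eq_zero (y : ℝ) (a : EReal) : (y : EReal) - a = 0 ↔ (y : EReal) = a := by
  induction a with
  | bot => simp
  | top => simp
  | coe a => norm_cast; exact sub_eq_zero

lemma sub_coe_le_zero (y : ℝ) (a : EReal) : a - (y : EReal) ≤ 0 ↔ a ≤ (y : EReal) := by
  induction a with
  | bot => simp
  | top => simp
  | coe a => norm_cast; exact sub_nonpos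

lemma sub_coe_eq_zero (y : ℝ) (a : EReal) : a - (y : EReal) = 0 ↔ (y : EReal) = a := by
  induction a with
  | bot => simp
  | top => simp
  | coe a => norm_cast; rw [sub_eq_zero, eq_comm]

lemma mem_feasible {p : Fin n → ℝ} :
    p ∈ feasible θl θu ↔ ∀ i, θl i ≤ (p i : EReal) ∧ (p i : EReal) ≤ θu i := by
  simp only [feasible, mem_ofPred_eq, Sum.forall, constr, coe_sub_le_zero, sub_coe_le_zero,
    forall_and, and_comm]

lemma inl_mem_active {p : Fin n → ℝ} {i : Fin n} :
    Sum.inl i ∈ active θl θu p ↔ (p i : EReal) = θu i := by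
  simp [active, constr, coe_sub_eq_zero]

lemma inr_mem_active {p : Fin n → ℝ} {i : Fin n} :
    Sum.inr i ∈ active θl θu p ↔ (p i : EReal) = θl i := by
  simp [active, constr, sub_coe_eq_zero]

lemma isClosed_feasible : IsClosed (feasible θl θu) := by
  have : feasible θl θu =
      ⋂ i, ({p | θl i ≤ (p i : EReal)} ∩ {p | (p i : EReal) ≤ θu i}) := by
    ext p; simp [mem_feasible]
  rw [this]
  have h (i : Fin n) : Continuous fun p : Fin n → ℝ => (p i : EReal) :=
    continuous_coe_real_ereal.comp (continuous_apply i)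
  exact isClosed_iInter fun i =>
    (isClosed_le continuous_const (h i)).inter (isClosed_le (h i) continuous_const)

lemma constrJac_inl_dotProduct (i : Fin n) (u : Fin n → ℝ) :
    constrJac n (Sum.inl i) ⬝ᵥ u = u i := by
  have : constrJac n (Sum.inl i) = Pi.single i 1 := by
    ext j; simp [constrJac, Matrix.one_apply, Pi.single_apply, eq_comm]
  simp [this]

lemma constrJac_inr_dotProduct (i : Fin n) (u : Fin n → ℝ) :
    constrJac n (Sum.inr i) ⬝ᵥ u = -u i := by
  have : constrJac n (Sum.inr i) = -Pi.single i 1 := by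
    ext j; simp [constrJac, Matrix.one_apply, Pi.single_apply, eq_comm]
  simp [this]

lemma constrJac_transpose_mulVec (π : Fin n ⊕ Fin n → ℝ) (i : Fin n) :
    ((constrJac n)ᵀ *ᵥ π) i = π (Sum.inl i) - π (Sum.inr i) := by
  simp [constrJac, Matrix.mulVec, dotProduct, Matrix.one_apply, Fintype.sum_sum_type,
    sub_eq_add_neg]

lemma isDiag_mulVec {A : Matrix (Fin n) (Fin n) ℝ} (hA : A.IsDiag) (w : Fin n → ℝ) (i : Fin n) :
    (A *ᵥ w) i = A i i * w i := by
  conv_lhs => rw [← hA.diagonal_diag]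
  simp [Matrix.mulVec_diagonal]

lemma isDiag_inv_mulVec {A : Matrix (Fin n) (Fin n) ℝ} (hA : A.IsDiag) (h0 : ∀ i, A i i ≠ 0)
    (w : Fin n → ℝ) (i : Fin n) : (A⁻¹ *ᵥ w) i = w i / A i i := by
  have h : A⁻¹ = Matrix.diagonal fun i => (A i i)⁻¹ := by
    apply Matrix.inv_eq_right_inv
    conv_lhs => rw [← hA.diagonal_diag]
    rw [Matrix.diagonal_mul_diagonal, ← Matrix.diagonal_one]
    congr 1; ext i; simp [h0 i]
  rw [h, Matrix.mulVec_diagonal]; field_simp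

/-! ### The velocity field, its dissipation and its equilibria. -/

/-- The input `-K_θ f_θ` of the limited integrators. -/
noncomputable def drive (f : (Fin n → ℝ) → ℝ) (K : (Fin n → ℝ) → Matrix (Fin n) (Fin n) ℝ)
    (p : Fin n → ℝ) : Fin n → ℝ :=
  -(K p *ᵥ grad f p)

/-- The velocity of the limited integrators. -/
noncomputable def rate (f : (Fin n → ℝ) → ℝ) (K : (Fin n → ℝ) → Matrix (Fin n) (Fin n) ℝ)
    (θl θu : Fin n → EReal) (p : Fin n → ℝ) : Fin n → ℝ :=
  fun i => limitedRate (θl i) (θu i) (p i) (drive f K p i)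

lemma drive_apply {p : Fin n → ℝ} (hK : (K p).IsDiag) (i : Fin n) :
    drive f K p i = -(K p i i * grad f p i) := by
  simp [drive, isDiag_mulVec hK]

lemma limitedRate_eq_or (b a : EReal) (y x : ℝ) :
    limitedRate b a y x = x ∨
      limitedRate b a y x = 0 ∧ ((y : EReal) = a ∧ 0 ≤ x ∨ (y : EReal) = b ∧ x ≤ 0) := by
  unfold limitedRate; split_ifs <;> simp_all

lemma abs_limitedRate_le (b a : EReal) (y x : ℝ) : |limitedRate b a y x| ≤ |x| := by
  rcases limitedRate_eq_or b a y x with h | ⟨h, -⟩ <;> simp [h]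

lemma limitedRate_of_ne_of_pos {b a : EReal} {y x : ℝ} (hy : (y : EReal) ≠ a) (hx : 0 < x) :
    limitedRate b a y x = x := by
  simp [limitedRate, hy, hx.not_ge]

lemma limitedRate_of_ne_of_neg {b a : EReal} {y x : ℝ} (hy : (y : EReal) ≠ b) (hx : x < 0) :
    limitedRate b a y x = x := by
  simp [limitedRate, hy, hx.not_ge]

/-- The rate is discontinuous, but the drive is not: this gives the local speed bounds. -/
lemma norm_rate_le (p : Fin n → ℝ) : ‖rate f K θl θu p‖ ≤ ‖drive f K p‖ :=
  (pi_norm_le_iff_of_nonneg (norm_nonneg _)).2 fun i =>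
    (abs_limitedRate_le _ _ _ _).trans (norm_le_pi_norm (drive f K p) i)

lemma continuous_grad (hf : ContDiff ℝ 1 f) : Continuous (grad f) :=
  continuous_pi fun _ => (hf.continuous_fderiv one_ne_zero).clm_apply continuous_const

lemma continuous_drive (hf : ContDiff ℝ 1 f) (hK : Continuous K) : Continuous (drive f K) :=
  (hK.matrix_mulVec (continuous_grad hf)).neg

lemma fderiv_apply_eq_sum (p v : Fin n → ℝ) :
    fderiv ℝ f p v = ∑ i, grad f p i * v i := by
  conv_lhs => rw [pi_eq_sum_univ' v]
  simp only [map_sum, map_smul, smul_eq_mul, grad]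
  refine Finset.sum_congr rfl fun i _ => ?_
  rw [mul_comm]

/-- The dissipation rate of `f` along the limited integrators. -/
noncomputable def dissipation (f : (Fin n → ℝ) → ℝ)
    (K : (Fin n → ℝ) → Matrix (Fin n) (Fin n) ℝ)
    (θl θu : Fin n → EReal) (p : Fin n → ℝ) : ℝ :=
  ∑ i, rate f K θl θu p i ^ 2 / K p i i

lemma dissipation_nonneg {p : Fin n → ℝ} (hK : (K p).PosDef) :
    0 ≤ dissipation f K θl θu p :=
  Finset.sum_nonneg fun _ _ => div_nonneg (sq_nonneg _) hK.diag_pos.le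

/-- In each coordinate the rate is either zero or `-Kᵢᵢ` times the partial derivative; both make the
summands agree. -/
lemma fderiv_rate {p : Fin n → ℝ} (hKd : (K p).IsDiag) (hK : (K p).PosDef) :
    fderiv ℝ f p (rate f K θl θu p) = -dissipation f K θl θu p := by
  rw [fderiv_apply_eq_sum, dissipation, ← Finset.sum_neg_distrib]
  refine Finset.sum_congr rfl fun i _ => ?_
  have hk : 0 < K p i i := hK.diag_pos
  have hx : drive f K p i = _ := drive_apply hKd i
  rcases limitedRate_eq_or (θl i) (θu i) (p i) (drive f K p i) with h | ⟨h, -⟩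
  · rw [rate, h, hx]; field_simp
  · rw [rate, h]; simp

/-- The negative and positive parts of the gradient serve as multipliers. A nonzero one at an
inactive bound would mean a drive towards that bound with nothing to block it, hence a nonzero rate.
-/
lemma isKKT_of_rate_eq_zero {p : Fin n → ℝ} (hKd : (K p).IsDiag) (hK : (K p).PosDef)
    (hp : p ∈ feasible θl θu) (h : rate f K θl θu p = 0) : IsKKT f θl θu p := by
  refine ⟨hp, Sum.elim (fun i => max (-grad f p i) 0) (fun i => max (grad f p i) 0), ?_, ?_, ?_⟩
  · ext i
    rw [Pi.add_apply, constrJac_transpose_mulVec]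
    rcases le_total (grad f p i) 0 with h0 | h0 <;> simp [h0]
  · rintro (i | i) _ <;> simp
  · rintro (i | i) hi
    · rw [inl_mem_active] at hi
      have hk : 0 < K p i i := hK.diag_pos
      simp only [Sum.elim_inl, max_eq_right_iff, neg_nonpos]
      by_contra! hg
      have hx : 0 < drive f K p i := by rw [drive_apply hKd]; nlinarith
      exact hx.ne' ((limitedRate_of_ne_of_pos hi hx).symm.trans (congrFun h i))
    · rw [inr_mem_active] at hi
      have hk : 0 < K p i i := hK.diag_pos
      simp only [Sum.elim_inr, max_eq_right_iff]
      by_contra! hg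
      have hx : drive f K p i < 0 := by rw [drive_apply hKd]; nlinarith
      exact hx.ne ((limitedRate_of_ne_of_neg hi hx).symm.trans (congrFun h i))

/-! ### The quadratic program -/

lemma mem_qpFeasible {p u : Fin n → ℝ} :
    u ∈ qpFeasible θl θu p ↔
      ∀ i, ((p i : EReal) = θu i → u i ≤ 0) ∧ ((p i : EReal) = θl i → 0 ≤ u i) := by
  simp only [qpFeasible, mem_ofPred_eq, Sum.forall, inl_mem_active, inr_mem_active,
    constrJac_inl_dotProduct, constrJac_inr_dotProduct, forall_and, Left.neg_nonpos_iff]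

lemma inl_mem_qpActive {p u : Fin n → ℝ} {i : Fin n} :
    Sum.inl i ∈ qpActive θl θu p u ↔ (p i : EReal) = θu i ∧ u i = 0 := by
  simp [qpActive, inl_mem_active, constrJac_inl_dotProduct]

lemma inr_mem_qpActive {p u : Fin n → ℝ} {i : Fin n} :
    Sum.inr i ∈ qpActive θl θu p u ↔ (p i : EReal) = θl i ∧ u i = 0 := by
  simp [qpActive, inr_mem_active, constrJac_inr_dotProduct]

lemma qpObjective_eq_sum {p : Fin n → ℝ} (hKd : (K p).IsDiag) (hK : (K p).PosDef)
    (u : Fin n → ℝ) :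
    qpObjective f K p u = ∑ i, (1 / 2 * (grad f p i * u i) + 1 / 4 * (u i ^ 2 / K p i i)) := by
  have hk (i : Fin n) : K p i i ≠ 0 := hK.diag_pos.ne'
  simp only [qpObjective, dotProduct, isDiag_inv_mulVec hKd hk, Finset.sum_add_distrib,
    Finset.mul_sum]
  congr 1
  refine Finset.sum_congr rfl fun i _ => ?_
  ring

lemma rate_mem_qpFeasible {p : Fin n → ℝ} (hb : ∀ i, θl i < θu i) :
    rate f K θl θu p ∈ qpFeasible θl θu p := by
  rw [mem_qpFeasible]
  refine fun i => ⟨fun h => ?_, fun h => ?_⟩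
  · simp only [rate, limitedRate]
    split_ifs <;> simp_all [le_of_lt]
  · have h' : ¬ (p i : EReal) = θu i := by rw [h]; exact (hb i).ne
    simp only [rate, limitedRate]
    split_ifs <;> simp_all [le_of_lt]

/-- Quadratic growth at the minimizer, which yields optimality and uniqueness together. In a free
coordinate it is completion of the square, with equality; in a blocked one the slack is half of
`grad f p i * w i`, nonnegative by the sign constraint on `w i`. -/
lemma qpObjective_rate_add_le {p w : Fin n → ℝ} (hKd : (K p).IsDiag) (hK : (K p).PosDef)
    (hw : w ∈ qpFeasible θl θu p) :
    qpObjective f K p (rate f K θl θu p) +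
      ∑ i, 1 / 4 * ((w i - rate f K θl θu p i) ^ 2 / K p i i) ≤ qpObjective f K p w := by
  rw [qpObjective_eq_sum hKd hK, qpObjective_eq_sum hKd hK, ← Finset.sum_add_distrib]
  refine Finset.sum_le_sum fun i _ => ?_
  have hk : 0 < K p i i := hK.diag_pos
  have hx : drive f K p i = _ := drive_apply hKd i
  rw [mem_qpFeasible] at hw
  obtain ⟨h1, h2⟩ := hw i
  rcases limitedRate_eq_or (θl i) (θu i) (p i) (drive f K p i) with h | ⟨h, h'⟩
  · rw [rate, h, hx]
    apply le_of_eq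
    field_simp
    ring
  · rw [rate, h]
    have : 0 ≤ grad f p i * w i := by
      rcases h' with ⟨ha, hd⟩ | ⟨ha, hd⟩ <;> rw [hx] at hd
      · exact mul_nonneg_of_nonpos_of_nonpos (by nlinarith) (h1 ha)
      · exact mul_nonneg (by nlinarith) (h2 ha)
    simp only [mul_zero, sub_zero]
    ring_nf
    linarith

lemma isQPSolution_iff {p u : Fin n → ℝ} (hKd : (K p).IsDiag) (hK : (K p).PosDef)
    (hb : ∀ i, θl i < θu i) :
    IsQPSolution f K θl θu p u ↔ u = rate f K θl θu p := by
  have hnn (w : Fin n → ℝ) (i : Fin n) :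
      0 ≤ 1 / 4 * ((w i - rate f K θl θu p i) ^ 2 / K p i i) :=
    mul_nonneg (by norm_num) (div_nonneg (sq_nonneg _) hK.diag_pos.le)
  constructor
  · rintro ⟨hu, hmin⟩
    have h1 := hmin (rate f K θl θu p) (rate_mem_qpFeasible hb)
    have h2 := qpObjective_rate_add_le (f := f) hKd hK hu
    have h3 : ∑ i, 1 / 4 * ((u i - rate f K θl θu p i) ^ 2 / K p i i) = 0 :=
      le_antisymm (by linarith) (Finset.sum_nonneg fun i _ => hnn u i)
    ext i
    have h4 := (Finset.sum_eq_zero_iff_of_nonneg fun i _ => hnn u i).1 h3 i (Finset.mem_univ i)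
    have hk : K p i i ≠ 0 := hK.diag_pos.ne'
    simpa [hk, sub_eq_zero] using h4
  · rintro rfl
    refine ⟨rate_mem_qpFeasible hb, fun w hw => ?_⟩
    have := qpObjective_rate_add_le (f := f) hKd hK hw
    have := Finset.sum_nonneg fun i (_ : i ∈ Finset.univ) => hnn w i
    linarith

/-! ### The multiplier system of the general method. -/

/-- The coordinate that a constraint of the box bounds. -/
def coord : Fin n ⊕ Fin n → Fin n :=
  Sum.elim id id

/-- The nonzero entry of a row of the constraint Jacobian. -/
def rowSign : Fin n ⊕ Fin n → ℝ :=
  Sum.elim (fun _ => 1) (fun _ => -1)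

lemma constrJac_apply (k : Fin n ⊕ Fin n) (j : Fin n) :
    constrJac n k j = if coord k = j then rowSign k else 0 := by
  rcases k with i | i <;> by_cases h : i = j <;> simp [constrJac, coord, rowSign, h]

lemma rowSign_mul_self (k : Fin n ⊕ Fin n) : rowSign k * rowSign k = 1 := by
  rcases k with i | i <;> simp [rowSign]

lemma subJac_mulVec (I : Set (Fin n ⊕ Fin n)) (w : Fin n → ℝ) (k : I) :
    (subJac I *ᵥ w) k = rowSign k.1 * w (coord k.1) := by
  simp [subJac, Matrix.mulVec, dotProduct, constrJac_apply]

-- The rows of `subJac I` are signed unit vectors, for distinct coordinates by `hI`. The signs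
-- square to one on the diagonal, and `A` vanishes off it.
open Classical in
lemma subJac_mul_mul_transpose {A : Matrix (Fin n) (Fin n) ℝ} (hA : A.IsDiag)
    {I : Set (Fin n ⊕ Fin n)} (hI : ∀ k ∈ I, ∀ l ∈ I, coord k = coord l → k = l) :
    subJac I * A * (subJac I)ᵀ =
      Matrix.diagonal fun k : I => A (coord k.1) (coord k.1) := by
  ext k l
  have h : (subJac I * A * (subJac I)ᵀ) k l =
      rowSign k.1 * A (coord k.1) (coord l.1) * rowSign l.1 := by
    simp [Matrix.mul_apply, subJac, constrJac_apply]
  rw [h]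
  by_cases hkl : k = l
  · subst hkl
    rw [Matrix.diagonal_apply_eq, mul_right_comm, rowSign_mul_self, one_mul]
  · rw [Matrix.diagonal_apply_ne _ hkl, hA fun hc => hkl (Subtype.ext (hI _ k.2 _ l.2 hc))]
    simp

open Classical in
lemma isGeneralVelocity_iff {p v : Fin n → ℝ} (hKd : (K p).IsDiag) (hK : (K p).PosDef)
    (hb : ∀ i, θl i < θu i) :
    IsGeneralVelocity f K θl θu p v ↔ v = rate f K θl θu p := by
  set r := rate f K θl θu p with hr
  set I := qpActive θl θu p r with hI
  have hk (i : Fin n) : 0 < K p i i := hK.diag_pos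
  have hx (i : Fin n) : drive f K p i = _ := drive_apply hKd i
  have hne (i : Fin n) : (p i : EReal) = θu i → (p i : EReal) ≠ θl i :=
    fun h h' => (hb i).ne (h'.symm.trans h)
  have hM : subJac I * K p * (subJac I)ᵀ =
      Matrix.diagonal fun k : I => K p (coord k.1) (coord k.1) := by
    -- Two distinct constraints on one coordinate are its two bounds, which cannot both be active
    -- because they differ.
    refine subJac_mul_mul_transpose hKd ?_
    rintro (i | i) hi (j | j) hj h <;> simp only [coord, Sum.elim_inl, Sum.elim_inr, id] at h <;>
      subst h
    · rfl
    · exact absurd (inr_mem_qpActive.1 hj).1 (hne _ (inl_mem_qpActive.1 hi).1)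
    · exact absurd (inr_mem_qpActive.1 hi).1 (hne _ (inl_mem_qpActive.1 hj).1)
    · rfl
  have hdet : IsUnit (subJac I * K p * (subJac I)ᵀ).det := by
    rw [hM, Matrix.det_diagonal, isUnit_iff_ne_zero]
    exact Finset.prod_ne_zero_iff.2 fun k _ => (hk _).ne'
  have hmult : -((subJac I * K p * (subJac I)ᵀ)⁻¹ *ᵥ (subJac I *ᵥ (K p *ᵥ grad f p))) =
      fun k : I => -(rowSign k.1 * grad f p (coord k.1)) := by
    have hinv : (subJac I * K p * (subJac I)ᵀ)⁻¹ =
        Matrix.diagonal fun k : I => (K p (coord k.1) (coord k.1))⁻¹ := by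
      rw [hM]
      apply Matrix.inv_eq_right_inv
      rw [Matrix.diagonal_mul_diagonal, ← Matrix.diagonal_one]
      congr 1; ext k; exact mul_inv_cancel₀ (hk _).ne'
    ext k
    have := (hk (coord k.1)).ne'
    rw [Pi.neg_apply, hinv, Matrix.mulVec_diagonal, subJac_mulVec, isDiag_mulVec hKd]
    field_simp
  -- A drive pointing inward is never blocked, so zero velocity at a bound fixes the sign of the
  -- gradient, hence of the multiplier.
  have hupper (i : Fin n) (hi : Sum.inl i ∈ I) : grad f p i ≤ 0 := by
    obtain ⟨h1, h2⟩ := inl_mem_qpActive.1 hi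
    by_contra! hg
    have hneg : drive f K p i < 0 := by rw [hx]; nlinarith [hk i]
    exact hneg.ne ((limitedRate_of_ne_of_neg (hne i h1) hneg).symm.trans h2)
  have hlower (i : Fin n) (hi : Sum.inr i ∈ I) : 0 ≤ grad f p i := by
    obtain ⟨h1, h2⟩ := inr_mem_qpActive.1 hi
    by_contra! hg
    have hpos : 0 < drive f K p i := by rw [hx]; nlinarith [hk i]
    exact hpos.ne' ((limitedRate_of_ne_of_pos (fun h => hne i h h1) hpos).symm.trans h2)
  -- On `I` the multiplier cancels the gradient. A coordinate without an index in `I` is not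
  -- blocked, since a blocked one lies at a bound with zero rate.
  have hvel (π : Fin n ⊕ Fin n → ℝ) (hoff : ∀ k ∉ I, π k = 0)
      (hon : ∀ k ∈ I, π k = -(rowSign k * grad f p (coord k))) :
      -(K p *ᵥ (grad f p + (constrJac n)ᵀ *ᵥ π)) = r := by
    ext i
    rw [Pi.neg_apply, isDiag_mulVec hKd, Pi.add_apply, constrJac_transpose_mulVec]
    have hri : r i = limitedRate (θl i) (θu i) (p i) (drive f K p i) := rfl
    have hu := hon (Sum.inl i)
    have hl := hon (Sum.inr i)
    simp only [rowSign, coord, Sum.elim_inl, Sum.elim_inr, id, one_mul, neg_mul, neg_neg] at hu hl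
    by_cases h1 : Sum.inl i ∈ I
    · have h2 : Sum.inr i ∉ I := fun h =>
        hne _ (inl_mem_qpActive.1 h1).1 (inr_mem_qpActive.1 h).1
      rw [hu h1, hoff _ h2, (inl_mem_qpActive.1 h1).2]; ring
    · by_cases h2 : Sum.inr i ∈ I
      · rw [hoff _ h1, hl h2, (inr_mem_qpActive.1 h2).2]; ring
      · rw [hoff _ h1, hoff _ h2]
        rw [inl_mem_qpActive] at h1
        rw [inr_mem_qpActive] at h2
        rcases limitedRate_eq_or (θl i) (θu i) (p i) (drive f K p i) with h | ⟨h, h' | h'⟩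
        · rw [hri, h, hx]; ring
        · exact absurd ⟨h'.1, hri.trans h⟩ h1
        · exact absurd ⟨h'.1, hri.trans h⟩ h2
  constructor
  · rintro ⟨u, hu, π, hoff, -, -, hon, rfl⟩
    obtain rfl : u = r := (isQPSolution_iff hKd hK hb).1 hu
    refine hvel π hoff fun k hk => ?_
    exact (congrFun hon ⟨k, hk⟩).trans (congrFun hmult ⟨k, hk⟩)
  · rintro rfl
    let π : Fin n ⊕ Fin n → ℝ := fun k =>
      if k ∈ I then -(rowSign k * grad f p (coord k)) else 0
    have hoff : ∀ k ∉ I, π k = 0 := fun k hk => if_neg hk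
    have hon : ∀ k ∈ I, π k = -(rowSign k * grad f p (coord k)) := fun k hk => if_pos hk
    refine ⟨r, (isQPSolution_iff hKd hK hb).2 rfl, π, hoff, ?_, hdet, ?_, (hvel π hoff hon).symm⟩
    · rintro (i | i) hi
      · rw [hon _ hi]; simpa [rowSign, coord] using hupper i hi
      · rw [hon _ hi]; simpa [rowSign, coord] using hlower i hi
    · refine Eq.trans ?_ hmult.symm
      ext k
      exact hon _ k.2

end

end BoxDynamics

namespace BoxDynamics

section

variable {n : ℕ} {f : (Fin n → ℝ) → ℝ} {K : (Fin n → ℝ) → Matrix (Fin n) (Fin n) ℝ}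
  {θl θu : Fin n → EReal} {τ₀ : ℝ} {θ₀ : Fin n → ℝ} {θ : ℝ → Fin n → ℝ}

/-! ### Trajectories as vector-valued integral equations. -/

lemma intervalIntegrable_pi_iff {v : ℝ → Fin n → ℝ} {a b : ℝ} :
    IntervalIntegrable v volume a b ↔ ∀ i, IntervalIntegrable (fun s => v s i) volume a b := by
  simp only [intervalIntegrable_iff, IntegrableOn]
  exact ⟨fun h i => h.eval i, Integrable.of_eval⟩

lemma intervalIntegral_apply {v : ℝ → Fin n → ℝ} {a b : ℝ}
    (hv : IntervalIntegrable v volume a b) (i : Fin n) :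
    (∫ s in a..b, v s) i = ∫ s in a..b, v s i :=
  ((ContinuousLinearMap.proj (R := ℝ) (φ := fun _ : Fin n => ℝ) i).intervalIntegral_comp_comm
    hv).symm

lemma isLimitedSolution_iff :
    IsLimitedSolution f K θl θu τ₀ θ₀ θ ↔ ∀ t, τ₀ ≤ t → θ t ∈ feasible θl θu ∧
      IntervalIntegrable (fun s => rate f K θl θu (θ s)) volume τ₀ t ∧
      θ t = θ₀ + ∫ s in τ₀..t, rate f K θl θu (θ s) := by
  constructor
  · intro h t ht
    have hint : IntervalIntegrable (fun s => rate f K θl θu (θ s)) volume τ₀ t :=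
      intervalIntegrable_pi_iff.2 fun i => (h i t ht).2.2.1
    refine ⟨mem_feasible.2 fun i => ⟨(h i t ht).1, (h i t ht).2.1⟩, hint, ?_⟩
    ext i
    rw [Pi.add_apply, intervalIntegral_apply hint]
    exact (h i t ht).2.2.2
  · intro h i t ht
    obtain ⟨h1, h2, h3⟩ := h t ht
    refine ⟨(mem_feasible.1 h1 i).1, (mem_feasible.1 h1 i).2, intervalIntegrable_pi_iff.1 h2 i, ?_⟩
    refine (congrFun h3 i).trans ?_
    rw [Pi.add_apply, intervalIntegral_apply h2]
    rfl

lemma isLimitedSolution_iff_isGeneralSolution (hKd : ∀ p, (K p).IsDiag)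
    (hK : ∀ p, (K p).PosDef) (hb : ∀ i, θl i < θu i) :
    IsLimitedSolution f K θl θu τ₀ θ₀ θ ↔ IsGeneralSolution f K θl θu τ₀ θ₀ θ := by
  rw [isLimitedSolution_iff]
  constructor
  · intro h
    refine ⟨fun s => rate f K θl θu (θ s), fun t ht => ⟨(h t ht).1, ?_, (h t ht).2⟩⟩
    exact (isGeneralVelocity_iff (hKd _) (hK _) hb).2 rfl
  · rintro ⟨v, hv⟩ t ht
    have heq : EqOn v (fun s => rate f K θl θu (θ s)) (uIcc τ₀ t) := fun s hs => by
      rw [uIcc_of_le ht] at hs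
      exact (isGeneralVelocity_iff (hKd _) (hK _) hb).1 (hv s hs.1).2.1
    obtain ⟨h1, -, h2, h3⟩ := hv t ht
    refine ⟨h1, h2.congr fun s hs => heq (uIoc_subset_uIcc hs), ?_⟩
    rw [h3, intervalIntegral.integral_congr heq]

lemma IsLimitedSolution.mem_feasible (h : IsLimitedSolution f K θl θu τ₀ θ₀ θ) {t : ℝ}
    (ht : τ₀ ≤ t) : θ t ∈ feasible θl θu :=
  (isLimitedSolution_iff.1 h t ht).1

lemma IsLimitedSolution.apply_initial (h : IsLimitedSolution f K θl θu τ₀ θ₀ θ) : θ τ₀ = θ₀ := by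
  simpa using (isLimitedSolution_iff.1 h τ₀ le_rfl).2.2

lemma IsLimitedSolution.intervalIntegrable (h : IsLimitedSolution f K θl θu τ₀ θ₀ θ)
    {a b : ℝ} (ha : τ₀ ≤ a) (hb : τ₀ ≤ b) :
    IntervalIntegrable (fun s => rate f K θl θu (θ s)) volume a b :=
  (isLimitedSolution_iff.1 h a ha).2.1.symm.trans (isLimitedSolution_iff.1 h b hb).2.1

lemma IsLimitedSolution.sub_eq_integral (h : IsLimitedSolution f K θl θu τ₀ θ₀ θ)
    {a b : ℝ} (ha : τ₀ ≤ a) (hb : τ₀ ≤ b) :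
    θ b - θ a = ∫ s in a..b, rate f K θl θu (θ s) := by
  rw [(isLimitedSolution_iff.1 h a ha).2.2, (isLimitedSolution_iff.1 h b hb).2.2,
    add_sub_add_left_eq_sub, intervalIntegral.integral_interval_sub_left
      (h.intervalIntegrable le_rfl hb) (h.intervalIntegrable le_rfl ha)]

lemma IsLimitedSolution.continuousOn (h : IsLimitedSolution f K θl θu τ₀ θ₀ θ)
    {a b : ℝ} (ha : τ₀ ≤ a) : ContinuousOn θ (Icc a b) := by
  rcases le_or_gt a b with hab | hab
  · have h1 := intervalIntegral.continuousOn_primitive_interval'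
      (h.intervalIntegrable ha (ha.trans hab)) left_mem_uIcc
    rw [uIcc_of_le hab] at h1
    refine (continuousOn_const.add h1).congr (f := fun t => θ a + _) fun t ht => ?_
    exact (add_eq_of_eq_sub' (h.sub_eq_integral ha (ha.trans ht.1)).symm).symm
  · simp [Icc_eq_empty hab.not_ge]

/-- The speed bound is asked on the open interval only, so that the estimate applies up to a first
exit time, when the trajectory has already left the ball. -/
lemma IsLimitedSolution.norm_sub_le (h : IsLimitedSolution f K θl θu τ₀ θ₀ θ)
    {a b M : ℝ} (ha : τ₀ ≤ a) (hab : a ≤ b)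
    (hM : ∀ s ∈ Ioo a b, ‖rate f K θl θu (θ s)‖ ≤ M) :
    ‖θ b - θ a‖ ≤ M * (b - a) := by
  rw [h.sub_eq_integral ha (ha.trans hab), ← abs_of_nonneg (sub_nonneg.2 hab)]
  refine intervalIntegral.norm_integral_le_of_norm_le_const_ae ?_
  filter_upwards [Measure.ae_ne volume b] with s hsb hs
  rw [uIoc_of_le hab] at hs
  exact hM s ⟨hs.1, lt_of_le_of_ne hs.2 hsb⟩

lemma IsLimitedSolution.exists_norm_rate_le (h : IsLimitedSolution f K θl θu τ₀ θ₀ θ)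
    (hf : ContDiff ℝ 1 f) (hKc : Continuous K) {a b : ℝ} (ha : τ₀ ≤ a) :
    ∃ M, ∀ s ∈ Icc a b, ‖rate f K θl θu (θ s)‖ ≤ M := by
  obtain ⟨M, hM⟩ := isCompact_Icc.exists_bound_of_continuousOn
    ((continuous_drive hf hKc).comp_continuousOn (h.continuousOn (b := b) ha))
  exact ⟨M, fun s hs => (norm_rate_le _).trans (hM s hs)⟩

/-! ### Decrease of `f` along trajectories. -/

lemma IsLimitedSolution.absolutelyContinuousOnInterval_comp
    (h : IsLimitedSolution f K θl θu τ₀ θ₀ θ)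
    (hf : ContDiff ℝ 1 f) (hKc : Continuous K) {a b : ℝ} (ha : τ₀ ≤ a) (hab : a ≤ b) :
    AbsolutelyContinuousOnInterval (fun t => f (θ t)) a b := by
  obtain ⟨M, hM⟩ := h.exists_norm_rate_le hf hKc (b := b) ha
  have hM0 : 0 ≤ M := (norm_nonneg _).trans (hM a (left_mem_Icc.2 hab))
  have hlip : LipschitzOnWith M.toNNReal θ (Icc a b) := by
    refine LipschitzOnWith.of_dist_le_mul fun s hs t ht => ?_
    rw [Real.coe_toNNReal _ hM0]
    wlog hst : s ≤ t generalizing s t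
    · rw [dist_comm, dist_comm s]; exact this t ht s hs (le_of_not_ge hst)
    rw [dist_comm, dist_comm s, dist_eq_norm, Real.dist_eq, abs_of_nonneg (sub_nonneg.2 hst)]
    exact h.norm_sub_le (ha.trans hs.1) hst fun r hr =>
      hM r ⟨hs.1.trans hr.1.le, hr.2.le.trans ht.2⟩
  obtain ⟨R, hR⟩ :=
    (isCompact_Icc.image_of_continuousOn (h.continuousOn (b := b) ha)).isBounded.subset_closedBall 0
  obtain ⟨C, hC⟩ := (hf.contDiffOn (s := Metric.closedBall (0 : Fin n → ℝ) R)).exists_lipschitzOnWith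
    one_ne_zero (convex_closedBall _ _) (isCompact_closedBall _ _)
  have := hC.comp hlip (mapsTo_iff_image_subset.2 hR)
  rw [← uIcc_of_le hab] at this
  exact this.absolutelyContinuousOnInterval

lemma IsLimitedSolution.ae_hasDerivAt_comp (h : IsLimitedSolution f K θl θu τ₀ θ₀ θ)
    (hf : ContDiff ℝ 1 f) (hKd : ∀ p, (K p).IsDiag) (hK : ∀ p, (K p).PosDef)
    {a b : ℝ} (ha : τ₀ ≤ a) (hab : a ≤ b) :
    ∀ᵐ t, t ∈ Ioo a b →
      HasDerivAt (fun t => f (θ t)) (-dissipation f K θl θu (θ t)) t := by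
  filter_upwards [(h.intervalIntegrable ha (ha.trans hab)).ae_hasDerivAt_integral] with t ht htab
  have h1 := (ht (by rw [uIcc_of_le hab]; exact Ioo_subset_Icc_self htab) a left_mem_uIcc).const_add
    (θ a)
  have h2 : HasDerivAt θ (rate f K θl θu (θ t)) t := by
    refine h1.congr_of_eventuallyEq ?_
    filter_upwards [Ioo_mem_nhds htab.1 htab.2] with s hs
    rw [← h.sub_eq_integral ha (ha.trans hs.1.le), add_sub_cancel]
  rw [← fderiv_rate (hKd _) (hK _)]
  exact ((hf.differentiable one_ne_zero).differentiableAt.hasFDerivAt).comp_hasDerivAt t h2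

/-- Absolute continuity lets the almost-everywhere derivative be integrated. Comparing that
derivative with a constant avoids integrating the dissipation itself. -/
lemma IsLimitedSolution.comp_sub_le (h : IsLimitedSolution f K θl θu τ₀ θ₀ θ)
    (hf : ContDiff ℝ 1 f) (hKc : Continuous K) (hKd : ∀ p, (K p).IsDiag)
    (hK : ∀ p, (K p).PosDef) {a b c : ℝ} (ha : τ₀ ≤ a) (hab : a ≤ b)
    (hc : ∀ t ∈ Ioo a b, c ≤ dissipation f K θl θu (θ t)) :
    f (θ b) - f (θ a) ≤ -c * (b - a) := by
  have hac := h.absolutelyContinuousOnInterval_comp hf hKc ha hab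
  have hconst : ∫ _ in a..b, -c = -c * (b - a) := by simp [mul_comm]
  rw [← hac.integral_deriv_eq_sub, ← hconst]
  refine intervalIntegral.integral_mono_ae_restrict hab hac.intervalIntegrable_deriv
    intervalIntegrable_const ?_
  rw [EventuallyLE, ae_restrict_iff' measurableSet_Icc]
  filter_upwards [h.ae_hasDerivAt_comp hf hKd hK ha hab, Measure.ae_ne volume a,
    Measure.ae_ne volume b] with t ht hta htb htab
  have htm : t ∈ Ioo a b := ⟨lt_of_le_of_ne htab.1 hta.symm, lt_of_le_of_ne htab.2 htb⟩
  rw [(ht htm).deriv]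
  exact neg_le_neg (hc t htm)

lemma IsLimitedSolution.antitoneOn_comp (h : IsLimitedSolution f K θl θu τ₀ θ₀ θ)
    (hf : ContDiff ℝ 1 f) (hKc : Continuous K) (hKd : ∀ p, (K p).IsDiag)
    (hK : ∀ p, (K p).PosDef) : AntitoneOn (fun t => f (θ t)) (Ici τ₀) := by
  intro a ha b _ hab
  have := h.comp_sub_le hf hKc hKd hK ha hab (c := 0) fun t _ => dissipation_nonneg (hK _)
  simp only at *
  linarith

/-! ### Cluster points are equilibria. -/

/-- Near a point that is not an equilibrium the dissipation rate is bounded away from zero,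
although it is discontinuous. -/
lemma exists_eventually_le_dissipation (hf : ContDiff ℝ 1 f) (hKc : Continuous K)
    (hK : ∀ p, (K p).PosDef) {p : Fin n → ℝ} (hp : rate f K θl θu p ≠ 0) :
    ∃ c > 0, ∀ᶠ q in 𝓝 p, c ≤ dissipation f K θl θu q := by
  obtain ⟨i, hi⟩ : ∃ i, rate f K θl θu p i ≠ 0 := Function.ne_iff.1 hp
  have hx : Continuous fun q => drive f K q i :=
    (continuous_apply i).comp (continuous_drive hf hKc)
  have hcoe : Continuous fun q : Fin n → ℝ => (q i : EReal) :=
    continuous_coe_real_ereal.comp (continuous_apply i)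
  have hpx : rate f K θl θu p i = drive f K p i :=
    (limitedRate_eq_or _ _ _ _).resolve_right fun h => hi h.1
  -- The drive keeps its sign near `p`, and the only bound that could block this sign is not
  -- attained at `p`, hence not nearby.
  have hrate : ∀ᶠ q in 𝓝 p, rate f K θl θu q i = drive f K q i := by
    rcases lt_or_gt_of_ne (hpx ▸ hi) with h0 | h0
    · have hne : (p i : EReal) ≠ θl i := fun h => hi <| by
        simp only [rate, limitedRate]; split_ifs <;> simp_all [h0.le]
      filter_upwards [hx.continuousAt.eventually_lt_const h0, hcoe.continuousAt.eventually_ne hne]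
        with q h1 h2 using limitedRate_of_ne_of_neg h2 h1
    · have hne : (p i : EReal) ≠ θu i := fun h => hi <| by
        simp only [rate, limitedRate]; split_ifs <;> simp_all [h0.le]
      filter_upwards [hx.continuousAt.eventually_const_lt h0, hcoe.continuousAt.eventually_ne hne]
        with q h1 h2 using limitedRate_of_ne_of_pos h2 h1
  have hk (q : Fin n → ℝ) : 0 < K q i i := (hK q).diag_pos
  have hcont : Continuous fun q => drive f K q i ^ 2 / K q i i :=
    (hx.pow 2).div (hKc.matrix_elem i i) fun q => (hk q).ne'
  have hpos : 0 < drive f K p i ^ 2 / K p i i :=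
    div_pos (sq_pos_of_ne_zero (hpx ▸ hi)) (hk p)
  refine ⟨_, half_pos hpos, ?_⟩
  filter_upwards [hrate, hcont.continuousAt.eventually_const_lt (half_lt_self hpos)] with q h1 h2
  refine h2.le.trans ?_
  rw [← h1]
  exact Finset.single_le_sum (f := fun j => rate f K θl θu q j ^ 2 / K q j j)
    (fun j _ => div_nonneg (sq_nonneg _) (hK q).diag_pos.le) (Finset.mem_univ i)

/-- A trajectory that starts in the half ball stays in the ball for a time that depends only on a
bound of its speed in the ball. -/
lemma IsLimitedSolution.mem_ball (h : IsLimitedSolution f K θl θu τ₀ θ₀ θ)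
    {p : Fin n → ℝ} {ρ M a b : ℝ} (hM : ∀ q ∈ Metric.ball p ρ, ‖rate f K θl θu q‖ ≤ M)
    (ha : τ₀ ≤ a) (hpa : θ a ∈ Metric.ball p (ρ / 2)) (hM0 : 0 ≤ M)
    (hb : M * (b - a) ≤ ρ / 2) {t : ℝ} (ht : t ∈ Icc a b) : θ t ∈ Metric.ball p ρ := by
  by_contra hout
  have hcont : ContinuousOn (fun s => dist (θ s) p) (Icc a b) :=
    (continuous_id.dist continuous_const).comp_continuousOn (h.continuousOn ha)
  have hcpt : IsCompact (Icc a b ∩ (fun s => dist (θ s) p) ⁻¹' Ici ρ) :=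
    isCompact_Icc.of_isClosed_subset
      (hcont.preimage_isClosed_of_isClosed isClosed_Icc isClosed_Ici) inter_subset_left
  -- At the first exit time `s` the distance to `p` is at least `ρ`, yet it is below `ρ / 2 + M * (s
  -- - a) ≤ ρ`.
  obtain ⟨s, ⟨hs, hsρ⟩, hmin⟩ := hcpt.exists_isLeast ⟨t, ht, not_lt.1 (Metric.mem_ball.not.1 hout)⟩
  have hlt : ∀ r ∈ Ioo a s, ‖rate f K θl θu (θ r)‖ ≤ M := fun r hr => by
    refine hM _ (Metric.mem_ball.2 (not_le.1 fun hr' => ?_))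
    exact hr.2.not_ge (hmin ⟨⟨hr.1.le, hr.2.le.trans hs.2⟩, hr'⟩)
  have h1 := h.norm_sub_le ha hs.1 hlt
  have h2 : M * (s - a) ≤ M * (b - a) :=
    mul_le_mul_of_nonneg_left (by linarith [hs.2]) hM0
  have h3 := dist_triangle (θ s) (θ a) p
  rw [dist_eq_norm (θ s) (θ a)] at h3
  rw [Metric.mem_ball] at hpa
  have h4 : ρ ≤ dist (θ s) p := hsρ
  linarith

lemma IsLimitedSolution.rate_eq_zero_of_mapClusterPt (h : IsLimitedSolution f K θl θu τ₀ θ₀ θ)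
    (hf : ContDiff ℝ 1 f) (hKc : Continuous K) (hKd : ∀ p, (K p).IsDiag)
    (hK : ∀ p, (K p).PosDef) {p : Fin n → ℝ} (hp : MapClusterPt p atTop θ) :
    rate f K θl θu p = 0 := by
  by_contra hne
  have hanti := h.antitoneOn_comp hf hKc hKd hK
  -- Later returns near `p` bring `f` close to `f p`, and `f` never increases in between.
  have hlow {t : ℝ} (ht : τ₀ ≤ t) : f p ≤ f (θ t) := by
    by_contra! hlt
    have hev : ∀ᶠ q in 𝓝 p, f (θ t) < f q := hf.continuous.continuousAt.eventually_const_lt hlt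
    obtain ⟨s, hs, hts⟩ := ((hp.frequently hev).and_eventually (eventually_ge_atTop t)).exists
    exact hs.not_ge (hanti ht (ht.trans hts) hts)
  obtain ⟨c, hc, hdiss⟩ := exists_eventually_le_dissipation hf hKc hK hne
  have hspeed : ∀ᶠ q in 𝓝 p, ‖drive f K q‖ < ‖drive f K p‖ + 1 :=
    (continuous_drive hf hKc).norm.continuousAt.eventually_lt_const (lt_add_one _)
  obtain ⟨ρ, hρ, hball⟩ := Metric.eventually_nhds_iff_ball.1 (hdiss.and hspeed)
  set M := ‖drive f K p‖ + 1 with hMdef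
  have hM : 0 < M := by positivity
  -- The least time to get from the half ball out of the ball at speed at most `M`.
  set Δ := ρ / 2 / M with hΔ
  have hΔpos : 0 < Δ := by positivity
  have hev : ∀ᶠ q in 𝓝 p, q ∈ Metric.ball p (ρ / 2) ∧ f q < f p + c * Δ :=
    (show ∀ᶠ q in 𝓝 p, q ∈ Metric.ball p (ρ / 2) from Metric.ball_mem_nhds p (half_pos hρ)).and
      (hf.continuous.continuousAt.eventually_lt_const (lt_add_of_pos_right _ (by positivity)))
  obtain ⟨t, ⟨htball, htf⟩, ht⟩ :=
    ((hp.frequently hev).and_eventually (eventually_ge_atTop τ₀)).exists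
  have hstay {s : ℝ} (hs : s ∈ Icc t (t + Δ)) : θ s ∈ Metric.ball p ρ :=
    h.mem_ball (fun q hq => (norm_rate_le q).trans (hball q hq).2.le) ht htball hM.le
      (by rw [add_sub_cancel_left, hΔ, mul_div_cancel₀ _ hM.ne']) hs
  have hdrop := h.comp_sub_le hf hKc hKd hK (b := t + Δ) ht (by linarith) fun s hs =>
    (hball _ (hstay (Ioo_subset_Icc_self hs))).1
  have := hlow (t := t + Δ) (by linarith)
  rw [add_sub_cancel_left] at hdrop
  linarith

lemma IsLimitedSolution.isKKT_of_mapClusterPt (h : IsLimitedSolution f K θl θu τ₀ θ₀ θ)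
    (hf : ContDiff ℝ 1 f) (hKc : Continuous K) (hKd : ∀ p, (K p).IsDiag)
    (hK : ∀ p, (K p).PosDef) {p : Fin n → ℝ} (hp : MapClusterPt p atTop θ) :
    IsKKT f θl θu p := by
  refine isKKT_of_rate_eq_zero (hKd p) (hK p) ?_ (h.rate_eq_zero_of_mapClusterPt hf hKc hKd hK hp)
  by_contra hout
  obtain ⟨t, ht, ht'⟩ := ((hp.frequently (isClosed_feasible.isOpen_compl.mem_nhds hout)).and_eventually
    (eventually_ge_atTop τ₀)).exists
  exact ht (h.mem_feasible ht')

/-- Applied to the whole space it gives existence of KKT points; applied to the points at distance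
at least `ε` from the KKT set it gives convergence. -/
lemma IsLimitedSolution.exists_isKKT_of_frequently (h : IsLimitedSolution f K θl θu τ₀ θ₀ θ)
    (hf : ContDiff ℝ 1 f) (hKc : Continuous K) (hKd : ∀ p, (K p).IsDiag)
    (hK : ∀ p, (K p).PosDef) (hbdd : Bornology.IsBounded (θ '' Ici τ₀)) {s : Set (Fin n → ℝ)}
    (hs : IsClosed s) (hfreq : ∃ᶠ t in atTop, θ t ∈ s) : ∃ p ∈ s, IsKKT f θl θu p := by
  have hcpt : IsCompact (closure (θ '' Ici τ₀) ∩ s) := hbdd.isCompact_closure.inter_right hs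
  have hfreq' : ∃ᶠ t in atTop, θ t ∈ closure (θ '' Ici τ₀) ∩ s :=
    (hfreq.and_eventually (eventually_ge_atTop τ₀)).mono fun t ht =>
      ⟨subset_closure (mem_image_of_mem θ ht.2), ht.1⟩
  obtain ⟨p, hp, hclus⟩ := hcpt.exists_mapClusterPt_of_frequently hfreq'
  exact ⟨p, hp.2, h.isKKT_of_mapClusterPt hf hKc hKd hK hclus⟩

lemma IsLimitedSolution.tendsto_infDist (h : IsLimitedSolution f K θl θu τ₀ θ₀ θ)
    (hf : ContDiff ℝ 1 f) (hKc : Continuous K) (hKd : ∀ p, (K p).IsDiag)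
    (hK : ∀ p, (K p).PosDef) (hbdd : Bornology.IsBounded (θ '' Ici τ₀)) :
    Tendsto (fun t => Metric.infDist (θ t) {p | IsKKT f θl θu p}) atTop (𝓝 0) := by
  rw [Metric.tendsto_nhds]
  intro ε hε
  by_contra hnot
  have hcl : IsClosed {q | ε ≤ Metric.infDist q {p | IsKKT f θl θu p}} :=
    isClosed_le continuous_const (Metric.continuous_infDist_pt _)
  obtain ⟨p, hp, hkkt⟩ := h.exists_isKKT_of_frequently hf hKc hKd hK hbdd hcl <|
    (not_eventually.1 hnot).mono fun t ht => by
      rw [Real.dist_0_eq_abs, abs_of_nonneg Metric.infDist_nonneg] at ht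
      exact not_lt.1 ht
  exact hε.not_ge (hp.trans (Metric.infDist_zero_of_mem (s := {p | IsKKT f θl θu p}) hkkt).le)

end

end BoxDynamics

theorem theorem2 {n : ℕ} (f : (Fin n → ℝ) → ℝ) (hf : ContDiff ℝ 1 f)
    (θl θu : Fin n → EReal)
    (K : (Fin n → ℝ) → Matrix (Fin n) (Fin n) ℝ) (hKcont : Continuous K)
    (hKdiag : ∀ θ, (K θ).IsDiag) (hKpos : ∀ θ, (K θ).PosDef)
    (τ₀ : ℝ) (θ₀ : Fin n → ℝ) (hθ₀ : θ₀ ∈ BoxDynamics.feasible θl θu) :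
    -- the limited integrator and the general dynamic method give the same dynamics
    ((∀ i, θl i < θu i) →
      (∀ θ ∈ BoxDynamics.feasible θl θu, ∀ v : Fin n → ℝ,
        BoxDynamics.IsGeneralVelocity f K θl θu θ v ↔
          v = fun i => BoxDynamics.limitedRate (θl i) (θu i) (θ i)
            ((-(K θ *ᵥ BoxDynamics.grad f θ)) i)) ∧
      (∀ θ : ℝ → Fin n → ℝ,
        BoxDynamics.IsLimitedSolution f K θl θu τ₀ θ₀ θ ↔
          BoxDynamics.IsGeneralSolution f K θl θu τ₀ θ₀ θ)) ∧
    -- the trajectories satisfy the optimality conditions as `τ → +∞`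
    (∀ θ : ℝ → Fin n → ℝ, BoxDynamics.IsLimitedSolution f K θl θu τ₀ θ₀ θ →
      (∀ θhat, MapClusterPt θhat atTop θ → BoxDynamics.IsKKT f θl θu θhat) ∧
      (Bornology.IsBounded {p | p ∈ BoxDynamics.feasible θl θu ∧ f p ≤ f θ₀} →
        Bornology.IsBounded (θ '' Ici τ₀)) ∧
      (Bornology.IsBounded (θ '' Ici τ₀) →
        {p | BoxDynamics.IsKKT f θl θu p}.Nonempty ∧
        Tendsto (fun τ => Metric.infDist (θ τ) {p | BoxDynamics.IsKKT f θl θu p})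
          atTop (𝓝 0))) := by
  refine ⟨fun hb => ⟨fun p _ v => BoxDynamics.isGeneralVelocity_iff (hKdiag p) (hKpos p) hb,
    fun θ => BoxDynamics.isLimitedSolution_iff_isGeneralSolution hKdiag hKpos hb⟩,
    fun θ h => ⟨fun p hp => h.isKKT_of_mapClusterPt hf hKcont hKdiag hKpos hp, fun hbdd => ?_,
    fun hbdd => ⟨?_, h.tendsto_infDist hf hKcont hKdiag hKpos hbdd⟩⟩⟩
  · refine hbdd.subset ?_
    rintro _ ⟨t, ht, rfl⟩
    refine ⟨h.mem_feasible ht, ?_⟩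
    rw [← h.apply_initial]
    exact h.antitoneOn_comp hf hKcont hKdiag hKpos self_mem_Ici ht ht
  -- `Metric.infDist` to the empty set is `0`, so convergence has content only together with this
  -- nonemptiness.
  · obtain ⟨p, -, hp⟩ := h.exists_isKKT_of_frequently hf hKcont hKdiag hKpos hbdd isClosed_univ
      (Eventually.frequently (Eventually.of_forall fun t => mem_univ _))
    exact ⟨p, hp⟩
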